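/- **Setting.** Fix $T,\lambda>0$ and types $\theta,\tilde\theta\in[\theta_L,\theta_H]$, a risk aversion $\gamma(\cdot)>0$ and a risk loading $\xi(\cdot)\ge 0$ on $[\theta_L,\theta_H]$. For each type $\vartheta\in[\theta_L,\theta_H]$ let $f(\cdot;\vartheta)$ be a probability density on $(0,\infty)$ with finite first and second moments. The claims of a type-$\theta$ customer arrive on $[0,T]$ according to a Poisson process $N$ of intensity $\lambda$, and the claim sizes $Y_1,Y_2,\dots$ are i.i.d. with density $f(\cdot;\theta)$ and independent of $N$; let $N^\theta(ds,dy)$ be the associated jump measure on $[0,T]\times(0,\infty)$. An admissible coverage is a Borel function $l(t,y)$ with $0\le l(t,y)\le y$ for $t\in[0,T]$, $y\ge0$. Under the type-$\tilde\theta$ contract the coverage $l$ costs the premium rate $p_s(l)=(1+\xi(\tilde\theta))\lambda\int_0^\infty l(s,y)f(y;\tilde\theta)\,dy$ at time $s$. The surplus at time $T$ of a type-$\theta$ customer whose surplus at time $t$ is $x$ is $$X^{t,x}_T(l)=x-\int_t^T p_s(l)\,ds-\int_{(t,T]}\int_{(0,\infty)}(y-l(s,y))\,N^\theta(ds,dy),$$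 and $J(t,x,l)=\mathbb E[X^{t,x}_T(l)]-\frac{\gamma(\theta)}2\operatorname{Var}[X^{t,x}_T(l)]$. The customer's problem, with initial surplus $x_C$, is $V_C^\theta(\tilde\theta)=\sup_l J(0,x_C,l)$ over admissible $l$. An admissible $\hat l$ is an equilibrium strategy if for all $(t,x)\in[0,T]\times\mathbb R$ and all $\bar l:\mathbb R\to\mathbb R$ such that the perturbed strategies $l^\varepsilon$ (equal to $\bar l(y)$ for $s\in[t,t+\varepsilon)$ and to $\hat l(s,y)$ otherwise) are admissible for all small $\varepsilon>0$, one has $\liminf_{\varepsilon\downarrow0}\frac{J(t,x,\hat l)-J(t,x,l^\varepsilon)}{\varepsilon}\ge0$. **Proposition.** For every admissible $l$ and all $(t,x)\in[0,T]\times\mathbb R$ the surplus $X^{t,x}_T(l)$ is square-integrable. An optimal coverage for the customer's problem is $$\hat l^\theta(y;\tilde\theta)=\left(\left(y+\frac1{\gamma(\theta)}-\frac{f(y;\tilde\theta)(1+\xi(\tilde\theta))}{\gamma(\theta)f(y;\theta)}\right)\vee0\right)\wedge y,\qquad y>0$$ (read as $0$ where $f(y;\theta)=0$): it is an equilibrium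 strategy, and it attains the supremum that defines $V_C^\theta(\tilde\theta)$. The value function is $$V_C^\theta(\tilde\theta)=J(0,x_C,\hat l^\theta(\cdot;\tilde\theta))=x_C-\lambda T\left[\int_0^\infty(1+\xi(\tilde\theta))\,\hat l^\theta(y;\tilde\theta)f(y;\tilde\theta)\,dy+\int_0^\infty\left(\big(y-\hat l^\theta(y;\tilde\theta)\big)+\frac{\gamma(\theta)}2\big(y-\hat l^\theta(y;\tilde\theta)\big)^2\right)f(y;\theta)\,dy\right].$$ -/

import Mathlib

open MeasureTheory ProbabilityTheory Filter Topology

noncomputable section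

namespace RiskType

/-- `g` is the density of a positive claim size with finite first and second moments
(only the values of `g` on `(0, ∞)` matter). -/
structure IsClaimDensity (g : ℝ → ℝ) : Prop where
  measurable : Measurable g
  nonneg : ∀ y, 0 < y → 0 ≤ g y
  lintegral_eq_one : ∫⁻ y in Set.Ioi (0 : ℝ), ENNReal.ofReal (g y) = 1
  integrable_mul : IntegrableOn (fun y => y * g y) (Set.Ioi 0)
  integrable_sq_mul : IntegrableOn (fun y => y ^ 2 * g y) (Set.Ioi 0)

/-- `N` is (the restriction to `[0, T]` of) a homogeneous Poisson process with intensity `lam`: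
a right-continuous counting process started at `0` whose increments are independent and
Poisson distributed. -/
structure IsPoissonProcess {Ω : Type*} [MeasurableSpace Ω] (P : Measure Ω) (T lam : ℝ)
    (N : ℝ → Ω → ℕ) : Prop where
  measurable : ∀ t ∈ Set.Icc 0 T, Measurable (N t)
  zero : ∀ ω, N 0 ω = 0
  monotone : ∀ ω, MonotoneOn (fun t => N t ω) (Set.Icc 0 T)
  rightContinuous : ∀ ω, ∀ t ∈ Set.Icc 0 T,
    ContinuousWithinAt (fun s => N s ω) (Set.Icc t T) t
  indepIncrements : HasIndepIncrements (fun (t : Set.Icc (0 : ℝ) T) ω => N t ω) P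
  law_increment : ∀ s ∈ Set.Icc 0 T, ∀ t ∈ Set.Icc 0 T, s ≤ t →
    HasLaw (fun ω => N t ω - N s ω) (poissonMeasure (Real.toNNReal (lam * (t - s)))) P

/-- The Cramér–Lundberg model on `[0, T]`: claims arrive according to the Poisson process `N`
with intensity `lam`; the claim sizes `Y 0, Y 1, …` (in order of arrival) are independent and
identically distributed with density `g` on `(0, ∞)`, and they are independent of `N`. -/
structure IsClaimModel {Ω : Type*} [MeasurableSpace Ω] (P : Measure Ω) (T lam : ℝ) (g : ℝ → ℝ)
    (N : ℝ → Ω → ℕ) (Y : ℕ → Ω → ℝ) : Prop where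
  poisson : IsPoissonProcess P T lam N
  law_claim : ∀ i, HasLaw (Y i)
    ((volume.restrict (Set.Ioi (0 : ℝ))).withDensity fun y => ENNReal.ofReal (g y)) P
  indep_claims : iIndepFun Y P
  indep_arrivals : IndepFun (fun ω (i : ℕ) => Y i ω)
    (fun ω (t : Set.Icc (0 : ℝ) T) => N t ω) P

/-- The arrival time of claim number `i` (counted from `0`); meaningful if `i < N T ω`. -/
def arrivalTime {Ω : Type*} (T : ℝ) (N : ℝ → Ω → ℕ) (i : ℕ) (ω : Ω) : ℝ :=
  sInf {s : ℝ | s ∈ Set.Icc 0 T ∧ i < N s ω}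

/-- The integral `∫_{(t, r]} ∫_{(0, ∞)} h(s, y) N(ds, dy)` of `h` against the jump measure: the
sum of `h` over the claims arriving during `(t, r]`. -/
def jumpIntegral {Ω : Type*} (T : ℝ) (N : ℝ → Ω → ℕ) (Y : ℕ → Ω → ℝ) (h : ℝ → ℝ → ℝ)
    (t r : ℝ) (ω : Ω) : ℝ :=
  ∑ i ∈ Finset.Ico (N t ω) (N r ω), h (arrivalTime T N i ω) (Y i ω)

/-- Admissible coverage functions `l(t, y)`: measurable, and the indemnity neither is negative
nor exceeds the loss. -/
def Admissible (T : ℝ) (l : ℝ → ℝ → ℝ) : Prop :=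
  Measurable (Function.uncurry l) ∧
    ∀ t ∈ Set.Icc 0 T, ∀ y, 0 ≤ y → 0 ≤ l t y ∧ l t y ≤ y

/-- Premium rate at time `s` for the coverage `l` by the expected-value principle, in a contract
with risk loading `ξ` that is priced with the claim density `g`. -/
def premiumRate (lam ξ : ℝ) (g : ℝ → ℝ) (l : ℝ → ℝ → ℝ) (s : ℝ) : ℝ :=
  (1 + ξ) * lam * ∫ y in Set.Ioi (0 : ℝ), l s y * g y

/-- The customer's surplus at time `r ≥ t` when it equals `x` at time `t`. -/
def surplus {Ω : Type*} (T lam ξ : ℝ) (g : ℝ → ℝ) (N : ℝ → Ω → ℕ) (Y : ℕ → Ω → ℝ)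
    (l : ℝ → ℝ → ℝ) (t x r : ℝ) (ω : Ω) : ℝ :=
  x - (∫ s in t..r, premiumRate lam ξ g l s) - jumpIntegral T N Y (fun s y => y - l s y) t r ω

/-- Mean–variance criterion `J(t, x, l)` of the terminal surplus, with risk aversion `a`, for the
surplus that equals `x` at time `t`. -/
def criterion {Ω : Type*} [MeasurableSpace Ω] (P : Measure Ω) (T lam ξ a : ℝ) (g : ℝ → ℝ)
    (N : ℝ → Ω → ℕ) (Y : ℕ → Ω → ℝ) (t x : ℝ) (l : ℝ → ℝ → ℝ) : ℝ :=
  (∫ ω, surplus T lam ξ g N Y l t x T ω ∂P)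
    - a / 2 * variance (surplus T lam ξ g N Y l t x T) P

open Classical in
/-- The coverage that follows `lbar` during `[t, t + ε)` and `l` at all other times. -/
def perturb (l : ℝ → ℝ → ℝ) (lbar : ℝ → ℝ) (t ε : ℝ) : ℝ → ℝ → ℝ :=
  fun s y => if s ∈ Set.Ico t (t + ε) then lbar y else l s y

/-- `l` is an equilibrium strategy for the criterion `J` over the horizon `[0, T]`. The lower limit
is taken in the extended reals. -/
def IsEquilibrium (T : ℝ) (J : ℝ → ℝ → (ℝ → ℝ → ℝ) → ℝ) (l : ℝ → ℝ → ℝ) : Prop :=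
  Admissible T l ∧
    ∀ t ∈ Set.Icc 0 T, ∀ x : ℝ, ∀ lbar : ℝ → ℝ,
      (∀ᶠ ε in 𝓝[>] (0 : ℝ), Admissible T (perturb l lbar t ε)) →
        (0 : EReal) ≤ liminf
          (fun ε : ℝ => (((J t x l - J t x (perturb l lbar t ε)) / ε : ℝ) : EReal)) (𝓝[>] 0)

/-- The value of the customer's problem `sup_l J(0, x, l)` over admissible coverages. -/
def customerValue (T : ℝ) (J : ℝ → ℝ → (ℝ → ℝ → ℝ) → ℝ) (x : ℝ) : ℝ :=
  sSup (J 0 x '' {l | Admissible T l})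

open Classical in
/-- The coverage `((y + 1/a - g̃(y)(1 + ξ)/(a g(y))) ∨ 0) ∧ y`, where `a` is the customer's risk
aversion, `g` the density of the customer's claims and `g̃` the density used for pricing. Where
`g y = 0` the quotient is read as `+∞`, so that the coverage is `0`. -/
def optimalCoverage (ξ a : ℝ) (gtilde g : ℝ → ℝ) (y : ℝ) : ℝ :=
  if g y = 0 then min 0 y
  else min (max (y + 1 / a - gtilde y * (1 + ξ) / (a * g y)) 0) y

end RiskType

end

/-!
The arrivals together with their claim sizes form a point process whose intensity is
`lam ds ⊗ g(y) dy` and whose second factorial moment measure is the square of its intensity. By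
Campbell's formula, a sum of `k` over its points therefore has mean `∫ k` and variance `∫ k ^ 2`
with respect to the intensity, so that `J(t, x, l)` equals `x` minus `lam` times the integral over
`(t, T] × (0, ∞)` of a cost that depends on `l` only through the value `l(s, y)`. As a function of
that value the cost is a convex quadratic, minimised on `[0, y]` by clipping its vertex, or, where
`g y = 0`, linear and nondecreasing, minimised by `0`. The resulting coverage maximises `J(t, x, ·)`
for every `(t, x)` at once, hence it is an equilibrium as well as optimal at time `0`.
-/

namespace RiskType

open scoped ENNReal NNReal

section PointProcess

variable {Ω α ι : Type*} [MeasurableSpace Ω] [MeasurableSpace α] {P : Measure Ω}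
  {I : Ω → Finset ι} {X : ι → Ω → α}

/-- The intensity (first moment) measure of the random point process with the points `X i ω`,
`i ∈ I ω`, counted with multiplicity. -/
noncomputable def intensity (P : Measure Ω) (I : Ω → Finset ι) (X : ι → Ω → α) : Measure α :=
  Measure.sum fun i => (P.restrict {ω | i ∈ I ω}).map (X i)

/-- The second factorial moment measure of a point process: the intensity measure of the process
of all pairs of points with different indices. -/
noncomputable def factorialMoment (P : Measure Ω) (I : Ω → Finset ι)
    (X : ι → Ω → α) : Measure (α × α) :=
  intensity P (fun ω => (I ω).offDiag) fun p ω => (X p.1 ω, X p.2 ω)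

lemma sum_mul_sum_eq_sum_add_sum_offDiag {R : Type*} [NonUnitalNonAssocSemiring R]
    (s : Finset ι) (f g : ι → R) :
    (∑ i ∈ s, f i) * ∑ i ∈ s, g i = ∑ i ∈ s, f i * g i + ∑ p ∈ s.offDiag, f p.1 * g p.2 := by
  classical
  rw [Finset.sum_mul_sum, ← Finset.sum_product', ← Finset.diag_union_offDiag,
    Finset.sum_union (Finset.disjoint_diag_offDiag s), Finset.sum_diag]

lemma measurableSet_mem_offDiag (hI : ∀ i, MeasurableSet {ω | i ∈ I ω})
    (p : ι × ι) : MeasurableSet {ω | p ∈ (I ω).offDiag} := by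
  simp only [Finset.mem_offDiag]
  exact (hI p.1).inter ((hI p.2).inter (.const _))

instance [Countable ι] [SFinite P] : SFinite (intensity P I X) := by
  unfold intensity
  infer_instance

lemma intensity_comp (hX : ∀ i, AEMeasurable (X i) P) {β : Type*} [MeasurableSpace β] {e : α → β}
    (he : Measurable e) : intensity P I (fun i ω => e (X i ω)) = (intensity P I X).map e := by
  rw [intensity, intensity, Measure.map_sum he.aemeasurable]
  congr 1 with i : 1
  exact (AEMeasurable.map_map_of_aemeasurable he.aemeasurable (hX i).restrict).symm

lemma hasSum_indicator_mem {Ω α E : Type*} [AddCommMonoid E] [TopologicalSpace E]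
    (I : Ω → Finset ι) (X : ι → Ω → α) (φ : α → E) (ω : Ω) :
    HasSum (fun i => {ω | i ∈ I ω}.indicator (φ ∘ X i) ω) (∑ i ∈ I ω, φ (X i ω)) := by
  have hsum : ∑ i ∈ I ω, φ (X i ω) = ∑ i ∈ I ω, {ω | i ∈ I ω}.indicator (φ ∘ X i) ω :=
    Finset.sum_congr rfl fun i hi => (Set.indicator_of_mem (s := {ω | i ∈ I ω}) hi (φ ∘ X i)).symm
  exact hsum ▸ hasSum_sum_of_ne_finset_zero fun i hi =>
    Set.indicator_of_notMem (s := {ω | i ∈ I ω}) hi _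

section Campbell

variable {E : Type*} [NormedAddCommGroup E] {φ : α → E}

variable (hI : ∀ i, MeasurableSet {ω | i ∈ I ω}) (hX : ∀ i, AEMeasurable (X i) P)
include hI hX

lemma aemeasurable_indicator_comp {φ : α → ℝ≥0∞} (hφ : AEMeasurable φ (intensity P I X)) (i : ι) :
    AEMeasurable ({ω | i ∈ I ω}.indicator (φ ∘ X i)) P :=
  (aemeasurable_indicator_iff (hI i)).2
    ((hφ.mono_measure (Measure.le_sum _ i)).comp_aemeasurable (hX i).restrict)

lemma aemeasurable_sum_comp [Countable ι] {φ : α → ℝ≥0∞}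
    (hφ : AEMeasurable φ (intensity P I X)) : AEMeasurable (fun ω => ∑ i ∈ I ω, φ (X i ω)) P := by
  simp_rw [← (hasSum_indicator_mem I X φ _).tsum_eq]
  exact AEMeasurable.tsum fun i => aemeasurable_indicator_comp hI hX hφ i

lemma lintegral_sum_comp [Countable ι] {φ : α → ℝ≥0∞} (hφ : AEMeasurable φ (intensity P I X)) :
    ∫⁻ ω, ∑ i ∈ I ω, φ (X i ω) ∂P = ∫⁻ x, φ x ∂intensity P I X := by
  simp_rw [← (hasSum_indicator_mem I X φ _).tsum_eq]
  rw [lintegral_tsum (aemeasurable_indicator_comp hI hX hφ), intensity, lintegral_sum_measure]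
  refine tsum_congr fun i => ?_
  rw [lintegral_indicator (hI i), lintegral_map' (hφ.mono_measure (Measure.le_sum _ i))
    (hX i).restrict, Function.comp_def]

lemma intensity_apply [Countable ι] {A : Set α} [DecidablePred (· ∈ A)] (hA : MeasurableSet A) :
    intensity P I X A = ∫⁻ ω, ((I ω).filter fun i => X i ω ∈ A).card ∂P := by
  rw [← lintegral_indicator_one hA,
    ← lintegral_sum_comp hI hX (measurable_one.indicator hA).aemeasurable]
  simp [Set.indicator_apply]

lemma factorialMoment_prod_add_intensity_inter [Countable ι] {A B : Set α}
    [DecidablePred (· ∈ A)] [DecidablePred (· ∈ B)] (hA : MeasurableSet A) (hB : MeasurableSet B) :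
    factorialMoment P I X (A ×ˢ B) + intensity P I X (A ∩ B) =
      ∫⁻ ω, ((I ω).filter fun i => X i ω ∈ A).card * ((I ω).filter fun i => X i ω ∈ B).card ∂P := by
  have hIo := measurableSet_mem_offDiag hI
  have hXo (p : ι × ι) : AEMeasurable (fun ω => (X p.1 ω, X p.2 ω)) P := (hX p.1).prodMk (hX p.2)
  have hind {S : Set (α × α)} (hS : MeasurableSet S) :
      AEMeasurable (S.indicator (1 : α × α → ℝ≥0∞)) (factorialMoment P I X) :=
    (measurable_one.indicator hS).aemeasurable
  rw [← lintegral_indicator_one (hA.prod hB), ← lintegral_indicator_one (hA.inter hB),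
    ← lintegral_sum_comp hI hX (measurable_one.indicator (hA.inter hB)).aemeasurable,
    factorialMoment, ← lintegral_sum_comp hIo hXo (hind (hA.prod hB)),
    ← lintegral_add_left' (aemeasurable_sum_comp hIo hXo (hind (hA.prod hB)))]
  refine lintegral_congr fun ω => ?_
  simp only [Finset.card_filter, Nat.cast_sum, sum_mul_sum_eq_sum_add_sum_offDiag, Nat.cast_ite,
    Nat.cast_one, Nat.cast_zero, Set.indicator_apply, Set.mem_prod, Set.mem_inter_iff,
    Pi.one_apply, ite_and, ite_mul, one_mul, zero_mul]
  rw [add_comm]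

lemma aestronglyMeasurable_indicator_comp (hφ : AEStronglyMeasurable φ (intensity P I X)) (i : ι) :
    AEStronglyMeasurable ({ω | i ∈ I ω}.indicator (φ ∘ X i)) P :=
  (aestronglyMeasurable_indicator_iff (hI i)).2
    ((hφ.mono_measure (Measure.le_sum _ i)).comp_aemeasurable (hX i).restrict)

lemma integrable_sum_comp [Countable ι] (hφ : Integrable φ (intensity P I X)) :
    Integrable (fun ω => ∑ i ∈ I ω, φ (X i ω)) P := by
  refine ⟨aestronglyMeasurable_of_tendsto_ae atTop
    (fun s => Finset.aestronglyMeasurable_fun_sum s fun i _ =>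
      aestronglyMeasurable_indicator_comp hI hX hφ.1 i)
    (ae_of_all _ fun ω => hasSum_indicator_mem I X φ ω), ?_⟩
  calc ∫⁻ ω, ‖∑ i ∈ I ω, φ (X i ω)‖ₑ ∂P
      ≤ ∫⁻ ω, ∑ i ∈ I ω, ‖φ (X i ω)‖ₑ ∂P := lintegral_mono fun ω => enorm_sum_le _ _
    _ = ∫⁻ x, ‖φ x‖ₑ ∂intensity P I X := lintegral_sum_comp hI hX hφ.1.enorm
    _ < ∞ := hφ.2

lemma integral_sum_comp [Countable ι] [NormedSpace ℝ E] (hφ : Integrable φ (intensity P I X)) :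
    ∫ ω, ∑ i ∈ I ω, φ (X i ω) ∂P = ∫ x, φ x ∂intensity P I X := by
  have hfin : ∑' i, ∫⁻ ω, ‖{ω | i ∈ I ω}.indicator (φ ∘ X i) ω‖ₑ ∂P ≠ ∞ := by
    rw [← lintegral_tsum fun i => (aestronglyMeasurable_indicator_comp hI hX hφ.1 i).enorm]
    refine ne_of_eq_of_ne (lintegral_congr fun ω => ?_)
      ((lintegral_sum_comp hI hX hφ.1.enorm).trans_ne hφ.2.ne)
    exact (tsum_congr fun i => enorm_indicator_eq_indicator_enorm _ _).trans
      (hasSum_indicator_mem I X (fun x => ‖φ x‖ₑ) ω).tsum_eq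
  simp_rw [← (hasSum_indicator_mem I X φ _).tsum_eq]
  rw [integral_tsum (aestronglyMeasurable_indicator_comp hI hX hφ.1) hfin,
    intensity, ← (hasSum_integral_measure hφ).tsum_eq]
  refine tsum_congr fun i => ?_
  rw [integral_indicator (hI i), integral_map (hX i).restrict
    (hφ.1.mono_measure (Measure.le_sum _ i)), Function.comp_def]

end Campbell

section Uncorrelated

variable [Countable ι] {φ : α → ℝ}
  (hI : ∀ i, MeasurableSet {ω | i ∈ I ω}) (hX : ∀ i, AEMeasurable (X i) P)
  (h₂ : factorialMoment P I X = (intensity P I X).prod (intensity P I X))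
  (hφ : Integrable φ (intensity P I X)) (hφ2 : Integrable (fun x => φ x ^ 2) (intensity P I X))
include hI hX h₂ hφ

lemma integrable_sum_offDiag :
    Integrable (fun ω => ∑ p ∈ (I ω).offDiag, φ (X p.1 ω) * φ (X p.2 ω)) P := by
  have hint : Integrable (fun x : α × α => φ x.1 * φ x.2) (factorialMoment P I X) :=
    h₂ ▸ hφ.mul_prod hφ
  exact integrable_sum_comp (measurableSet_mem_offDiag hI) (fun p => (hX p.1).prodMk (hX p.2)) hint

lemma integral_sum_offDiag [SFinite P] :
    ∫ ω, ∑ p ∈ (I ω).offDiag, φ (X p.1 ω) * φ (X p.2 ω) ∂P =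
      (∫ x, φ x ∂intensity P I X) ^ 2 := by
  have hint : Integrable (fun x : α × α => φ x.1 * φ x.2) (factorialMoment P I X) :=
    h₂ ▸ hφ.mul_prod hφ
  rw [sq, ← integral_prod_mul, ← h₂]
  exact integral_sum_comp (measurableSet_mem_offDiag hI) (fun p => (hX p.1).prodMk (hX p.2)) hint

include hφ2

lemma memLp_two_sum_comp : MemLp (fun ω => ∑ i ∈ I ω, φ (X i ω)) 2 P := by
  rw [memLp_two_iff_integrable_sq (integrable_sum_comp hI hX hφ).1]
  simp_rw [sq, sum_mul_sum_eq_sum_add_sum_offDiag, ← sq]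
  exact (integrable_sum_comp hI hX hφ2).add (integrable_sum_offDiag hI hX h₂ hφ)

lemma variance_sum_comp [IsProbabilityMeasure P] :
    variance (fun ω => ∑ i ∈ I ω, φ (X i ω)) P = ∫ x, φ x ^ 2 ∂intensity P I X := by
  rw [variance_eq_sub (memLp_two_sum_comp hI hX h₂ hφ hφ2), integral_sum_comp hI hX hφ]
  simp_rw [Pi.pow_apply, sq (∑ _ ∈ I _, _), sum_mul_sum_eq_sum_add_sum_offDiag, ← sq]
  rw [integral_add (integrable_sum_comp hI hX hφ2) (integrable_sum_offDiag hI hX h₂ hφ),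
    integral_sum_comp hI hX hφ2, integral_sum_offDiag hI hX h₂ hφ, add_sub_cancel_right]

end Uncorrelated

end PointProcess

section Marking

variable {Ω α β ι : Type*} {m mΩ : MeasurableSpace Ω} [MeasurableSpace α] [MeasurableSpace β]
  {P : Measure Ω} {ν : Measure β} {I : Ω → Finset ι} {X : ι → Ω → α} {U : ι → Ω → β}

lemma map_restrict_prodMk_of_indep [IsProbabilityMeasure P] (hm : m ≤ mΩ) {A : Set Ω}
    (hA : MeasurableSet[m] A) {X : Ω → α} (hX : Measurable[m] X) {U : Ω → β} (hU : HasLaw U ν P)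
    (hind : Indep (MeasurableSpace.comap U inferInstance) m P) :
    (P.restrict A).map (fun ω => (X ω, U ω)) = ((P.restrict A).map X).prod ν := by
  have : IsProbabilityMeasure ν := hU.isProbabilityMeasure_iff.1 inferInstance
  have hXΩ : Measurable X := hX.mono hm le_rfl
  refine (Measure.prod_eq fun S T hS hT => ?_).symm
  have hXS : MeasurableSet[m] (X ⁻¹' S ∩ A) := (hX hS).inter hA
  have hpre : (fun ω => (X ω, U ω)) ⁻¹' S ×ˢ T ∩ A = U ⁻¹' T ∩ (X ⁻¹' S ∩ A) := by
    ext; simp; tauto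
  rw [Measure.map_apply_of_aemeasurable (hXΩ.aemeasurable.prodMk hU.aemeasurable.restrict)
      (hS.prod hT), Measure.restrict_apply' (hm _ hA), hpre,
    (Indep_iff _ _ P).1 hind _ _ ⟨T, hT, rfl⟩ hXS, Measure.map_apply hXΩ hS,
    Measure.restrict_apply' (hm _ hA), ← hU.map_eq,
    Measure.map_apply_of_aemeasurable hU.aemeasurable hT, mul_comm]

lemma measurePreserving_prodProdProdComm {α β γ δ : Type*} [MeasurableSpace α] [MeasurableSpace β]
    [MeasurableSpace γ] [MeasurableSpace δ] (μa : Measure α) (μb : Measure β) (μc : Measure γ)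
    (μd : Measure δ) [SFinite μa] [SFinite μb] [SFinite μc] [SFinite μd] :
    MeasurePreserving (fun p : (α × β) × γ × δ => ((p.1.1, p.2.1), (p.1.2, p.2.2)))
      ((μa.prod μb).prod (μc.prod μd)) ((μa.prod μc).prod (μb.prod μd)) := by
  have hinner : MeasurePreserving (fun p : β × γ × δ => (p.2.1, p.1, p.2.2))
      (μb.prod (μc.prod μd)) (μc.prod (μb.prod μd)) :=
    (measurePreserving_prodAssoc μc μb μd).comp ((Measure.measurePreserving_swap.prod
      (.id μd)).comp (measurePreserving_prodAssoc μb μc μd).symm)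
  exact (measurePreserving_prodAssoc μa μc (μb.prod μd)).symm.comp
    (((MeasurePreserving.id μa).prod hinner).comp (measurePreserving_prodAssoc μa μb (μc.prod μd)))

variable [IsProbabilityMeasure P] (hm : m ≤ mΩ) (hI : ∀ i, MeasurableSet[m] {ω | i ∈ I ω})
  (hX : ∀ i, Measurable[m] (X i))
include hm hI hX

lemma intensity_prodMk (hU : ∀ i ω, i ∈ I ω → HasLaw (U i) ν P)
    (hind : ∀ i, Indep (MeasurableSpace.comap (U i) inferInstance) m P) [SFinite ν] :
    intensity P I (fun i ω => (X i ω, U i ω)) = (intensity P I X).prod ν := by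
  rw [intensity, intensity, Measure.prod_sum_left]
  congr 1 with i : 1
  rcases Set.eq_empty_or_nonempty {ω | i ∈ I ω} with hempty | ⟨ω, hω⟩
  · simp [hempty]
  · exact map_restrict_prodMk_of_indep hm (hI i) (hX i) (hU i ω hω) (hind i)

lemma factorialMoment_prodMk [Countable ι] (hU : ∀ i, HasLaw (U i) ν P)
    (hpair : Pairwise fun i j => IndepFun (U i) (U j) P)
    (hind : Indep (MeasurableSpace.comap (fun ω i => U i ω) inferInstance) m P) [SFinite ν]
    (h₂ : factorialMoment P I X = (intensity P I X).prod (intensity P I X)) :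
    factorialMoment P I (fun i ω => (X i ω, U i ω)) =
      ((intensity P I X).prod ν).prod ((intensity P I X).prod ν) := by
  have hpairs : intensity P (fun ω => (I ω).offDiag)
      (fun p ω => ((X p.1 ω, X p.2 ω), (U p.1 ω, U p.2 ω))) =
        ((intensity P I X).prod (intensity P I X)).prod (ν.prod ν) := by
    rw [← h₂]
    refine intensity_prodMk hm (@measurableSet_mem_offDiag _ _ m _ hI)
      (fun p => (hX p.1).prodMk (hX p.2)) (fun p ω hp => ?_) fun p => ?_
    · exact (indepFun_iff_hasLaw_prodMk_prod (hU p.1) (hU p.2)).1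
        (hpair (Finset.mem_offDiag.1 hp).2.2)
    · have hU_apply (i : ι) : Measurable[.comap (fun ω i => U i ω) inferInstance] (U i) :=
        (measurable_pi_apply i).comp (comap_measurable fun ω i => U i ω)
      exact indep_of_indep_of_le_left hind ((hU_apply p.1).prodMk (hU_apply p.2)).comap_le
  have hXU (p : ι × ι) : AEMeasurable (fun ω => ((X p.1 ω, X p.2 ω), (U p.1 ω, U p.2 ω))) P :=
    (((hX p.1).prodMk (hX p.2)).mono hm le_rfl).aemeasurable.prodMk
      ((hU p.1).aemeasurable.prodMk (hU p.2).aemeasurable)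
  rw [← (measurePreserving_prodProdProdComm _ _ _ _).map_eq, ← hpairs,
    ← intensity_comp hXU (by fun_prop), factorialMoment]

end Marking

section Poisson

lemma lintegral_cast_mul_poissonMeasure (r : ℝ≥0) (g : ℕ → ℝ≥0∞) :
    ∫⁻ n, n * g n ∂poissonMeasure r = r * ∫⁻ n, g (n + 1) ∂poissonMeasure r := by
  simp only [poissonMeasure, lintegral_sum_measure, lintegral_smul_measure, lintegral_dirac,
    smul_eq_mul]
  rw [tsum_eq_zero_add' ENNReal.summable, ← ENNReal.tsum_mul_left]
  simp only [Nat.cast_zero, zero_mul, mul_zero, zero_add]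
  refine tsum_congr fun n => ?_
  rw [← mul_assoc, ← mul_assoc]
  congr 1
  rw [← ENNReal.ofReal_natCast, ← ENNReal.ofReal_mul (by positivity), ← ENNReal.ofReal_coe_nnreal,
    ← ENNReal.ofReal_mul (by positivity), Nat.factorial_succ]
  congr 1
  push_cast
  field_simp
  ring

lemma lintegral_cast_poissonMeasure (r : ℝ≥0) : ∫⁻ n : ℕ, n ∂poissonMeasure r = r := by
  simpa using lintegral_cast_mul_poissonMeasure r fun _ => 1

lemma lintegral_cast_mul_self_poissonMeasure (r : ℝ≥0) :
    ∫⁻ n : ℕ, n * n ∂poissonMeasure r = r * (r + 1) := by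
  rw [lintegral_cast_mul_poissonMeasure r fun n => n]
  simp only [Nat.cast_add, Nat.cast_one]
  rw [lintegral_add_right _ measurable_const, lintegral_cast_poissonMeasure]
  simp

variable {Ω : Type*} [MeasurableSpace Ω] {P : Measure Ω} {T lam : ℝ} {N : ℝ → Ω → ℕ}

/-- The σ-algebra generated by the counting process `N` on `[0, T]`. -/
abbrev pathSigma {Ω : Type*} (T : ℝ) (N : ℝ → Ω → ℕ) : MeasurableSpace Ω :=
  MeasurableSpace.comap (fun ω (t : Set.Icc (0 : ℝ) T) => N t ω) inferInstance

/-- The intensity measure `lam ds` on `(0, T]` of the arrivals. -/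
noncomputable def rateMeasure (T lam : ℝ) : Measure ℝ :=
  ENNReal.ofReal lam • volume.restrict (Set.Ioc 0 T)

instance (T lam : ℝ) : IsFiniteMeasure (rateMeasure T lam) :=
  Measure.smul_finite _ ENNReal.ofReal_ne_top

lemma rateMeasure_Iic (hT : 0 ≤ T) (hlam : 0 ≤ lam) (a : ℝ) :
    rateMeasure T lam (Set.Iic a) = ENNReal.ofReal (lam * Set.projIcc 0 T hT a) := by
  have hinter : Set.Iic a ∩ Set.Ioc 0 T = Set.Ioc 0 (min T a) := by
    ext
    simp only [Set.mem_inter_iff, Set.mem_Iic, Set.mem_Ioc, le_min_iff]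
    tauto
  rw [rateMeasure, Measure.smul_apply, Measure.restrict_apply measurableSet_Iic, hinter,
    Real.volume_Ioc, smul_eq_mul, Set.coe_projIcc, ENNReal.ofReal_mul hlam, sub_zero]
  simp [ENNReal.ofReal_max]

lemma measurableSet_mem_range_pathSigma {Ω : Type*} {T : ℝ} (hT : 0 ≤ T) (N : ℝ → Ω → ℕ) (i : ℕ) :
    MeasurableSet[pathSigma T N] {ω | i ∈ Finset.range (N T ω)} := by
  simp only [Finset.mem_range]
  exact ⟨{z | i < z ⟨T, hT, le_rfl⟩},
    measurableSet_lt measurable_const (measurable_pi_apply _), rfl⟩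

lemma arrivalTime_nonneg {Ω : Type*} (T : ℝ) (N : ℝ → Ω → ℕ) (i : ℕ) (ω : Ω) :
    0 ≤ arrivalTime T N i ω :=
  Real.sInf_nonneg fun _ hs => hs.1.1

namespace IsPoissonProcess

variable (hN : IsPoissonProcess P T lam N)
include hN

lemma arrivalTime_le_iff {i : ℕ} {ω : Ω} (hi : i < N T ω) {s : ℝ} (hs : s ∈ Set.Icc 0 T) :
    arrivalTime T N i ω ≤ s ↔ i < N s ω := by
  refine ⟨fun hle => ?_, fun h => csInf_le ⟨0, fun _ hu => hu.1.1⟩ ⟨hs, h⟩⟩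
  by_contra! hs_before
  obtain ⟨δ, hδ, hconst⟩ := Metric.mem_nhdsWithin_iff.1 <|
    (hN.rightContinuous ω s hs).eventually ((isOpen_discrete {N s ω}).mem_nhds rfl)
  have hlater : s + δ ≤ arrivalTime T N i ω := by
    refine le_csInf ⟨T, ⟨hs.1.trans hs.2, le_rfl⟩, hi⟩ fun u ⟨hu, hiu⟩ => ?_
    by_contra! hlt
    have hsu : s ≤ u := by
      by_contra! hus
      exact (hs_before.trans_lt hiu).not_ge (hN.monotone ω hu hs hus.le)
    have hball : u ∈ Metric.ball s δ := by
      rw [Metric.mem_ball, Real.dist_eq, abs_of_nonneg (by linarith)]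
      linarith
    have hNu : N u ω = N s ω := hconst ⟨hball, hsu, hu.2⟩
    omega
  linarith

lemma arrivalTime_of_le {i : ℕ} {ω : Ω} (hi : N T ω ≤ i) : arrivalTime T N i ω = 0 := by
  have hempty : {s : ℝ | s ∈ Set.Icc 0 T ∧ i < N s ω} = ∅ :=
    Set.eq_empty_of_forall_notMem fun s ⟨hs, his⟩ =>
      (his.trans_le (hN.monotone ω hs ⟨hs.1.trans hs.2, le_rfl⟩ hs.2)).not_ge hi
  rw [arrivalTime, hempty, Real.sInf_empty]

lemma arrivalTime_le_iff_projIcc (hT : 0 ≤ T) {i : ℕ} {ω : Ω} (hi : i < N T ω) (a : ℝ) :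
    arrivalTime T N i ω ≤ a ↔ i < N (Set.projIcc 0 T hT a) ω := by
  rcases lt_or_ge a 0 with ha | ha
  · rw [Set.projIcc_of_le_left hT ha.le, hN.zero]
    simpa using ha.trans_le (arrivalTime_nonneg T N i ω)
  · rw [← hN.arrivalTime_le_iff hi (Set.projIcc 0 T hT a).2, Set.coe_projIcc,
      max_eq_right (le_min hT ha), le_min_iff,
      and_iff_right ((hN.arrivalTime_le_iff hi ⟨hT, le_rfl⟩).2 hi)]

lemma filter_arrivalTime_mem_Iic (hT : 0 ≤ T) (ω : Ω) (a : ℝ) :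
    ((Finset.range (N T ω)).filter fun i => arrivalTime T N i ω ∈ Set.Iic a) =
      Finset.range (N (Set.projIcc 0 T hT a) ω) := by
  have hle : N (Set.projIcc 0 T hT a) ω ≤ N T ω :=
    hN.monotone ω (Set.projIcc 0 T hT a).2 ⟨hT, le_rfl⟩ (Set.projIcc 0 T hT a).2.2
  ext i
  rw [Finset.mem_filter, Finset.mem_range, Finset.mem_range, Set.mem_Iic]
  exact ⟨fun h => (hN.arrivalTime_le_iff_projIcc hT h.1 a).1 h.2, fun h =>
    ⟨h.trans_le hle, (hN.arrivalTime_le_iff_projIcc hT (h.trans_le hle) a).2 h⟩⟩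

lemma measurable_arrivalTime_pathSigma (hT : 0 ≤ T) (i : ℕ) :
    Measurable[pathSigma T N] (arrivalTime T N i) := by
  refine @_root_.measurable_of_Iic ℝ Ω _ _ _ (_) _ _ _ _ fun a => ?_
  have hpre : arrivalTime T N i ⁻¹' Set.Iic a =
      (fun ω (t : Set.Icc (0 : ℝ) T) => N t ω) ⁻¹'
        {z | (i < z ⟨T, hT, le_rfl⟩ ∧ i < z (Set.projIcc 0 T hT a)) ∨
          (z ⟨T, hT, le_rfl⟩ ≤ i ∧ 0 ≤ a)} := by
    ext ω
    simp only [Set.mem_preimage, Set.mem_Iic, Set.mem_ofPred_eq]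
    rcases lt_or_ge i (N T ω) with hi | hi
    · simp [hN.arrivalTime_le_iff_projIcc hT hi, hi]
    · simp [hN.arrivalTime_of_le hi, hi, hi.not_gt]
  rw [hpre]
  exact ⟨_, ((measurableSet_lt measurable_const (measurable_pi_apply _)).inter
    (measurableSet_lt measurable_const (measurable_pi_apply _))).union
    ((measurableSet_le (measurable_pi_apply _) measurable_const).inter (.const _)), rfl⟩

lemma pathSigma_le : pathSigma T N ≤ ‹MeasurableSpace Ω› :=
  (measurable_pi_lambda _ fun t : Set.Icc (0 : ℝ) T => hN.measurable t t.2).comap_le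

lemma hasLaw {t : ℝ} (ht : t ∈ Set.Icc 0 T) :
    HasLaw (N t) (poissonMeasure (lam * t).toNNReal) P := by
  simpa [hN.zero] using hN.law_increment 0 ⟨le_rfl, ht.1.trans ht.2⟩ t ht ht.1

lemma lintegral_eval {t : ℝ} (ht : t ∈ Set.Icc 0 T) :
    ∫⁻ ω, N t ω ∂P = ENNReal.ofReal (lam * t) := by
  rw [(hN.hasLaw ht).lintegral_comp (f := fun n : ℕ => (n : ℝ≥0∞)) (by fun_prop),
    lintegral_cast_poissonMeasure, ENNReal.ofReal]

lemma lintegral_eval_mul (hlam : 0 ≤ lam) {s t : ℝ} (hs : s ∈ Set.Icc 0 T) (ht : t ∈ Set.Icc 0 T)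
    (hst : s ≤ t) :
    ∫⁻ ω, N s ω * N t ω ∂P =
      ENNReal.ofReal (lam * s) * ENNReal.ofReal (lam * t) + ENNReal.ofReal (lam * s) := by
  have hcast : Measurable fun n : ℕ => (n : ℝ≥0∞) := by fun_prop
  have hind : IndepFun (fun ω => (N s ω : ℝ≥0∞)) (fun ω => ((N t ω - N s ω : ℕ) : ℝ≥0∞)) P := by
    simpa [Function.comp_def, hN.zero] using (hN.indepIncrements.indepFun_sub_sub
      (r := ⟨0, le_rfl, hs.1.trans hs.2⟩) (s := ⟨s, hs⟩) (t := ⟨t, ht⟩) hs.1 hst).comp hcast hcast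
  have hdecomp (ω : Ω) : (N s ω * N t ω : ℝ≥0∞) =
      N s ω * N s ω + N s ω * ((N t ω - N s ω : ℕ) : ℝ≥0∞) := by
    rw [← mul_add, ← Nat.cast_add, Nat.add_sub_cancel' (hN.monotone ω hs ht hst)]
  have hNs : Measurable fun ω => (N s ω : ℝ≥0∞) := hcast.comp (hN.measurable s hs)
  have hincr : Measurable fun ω => ((N t ω - N s ω : ℕ) : ℝ≥0∞) :=
    hcast.comp ((hN.measurable t ht).sub (hN.measurable s hs))
  have hNs_sq : Measurable fun ω => (N s ω * N s ω : ℝ≥0∞) := hNs.mul hNs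
  simp_rw [hdecomp]
  rw [lintegral_add_left hNs_sq,
    lintegral_mul_eq_lintegral_mul_lintegral_of_indepFun'' hNs.aemeasurable hincr.aemeasurable hind,
    (hN.hasLaw hs).lintegral_comp (f := fun n : ℕ => (n * n : ℝ≥0∞)) (by fun_prop),
    lintegral_cast_mul_self_poissonMeasure, hN.lintegral_eval hs,
    (hN.law_increment s hs t ht hst).lintegral_comp (f := fun n : ℕ => (n : ℝ≥0∞)) (by fun_prop),
    lintegral_cast_poissonMeasure, ← ENNReal.ofReal, ← ENNReal.ofReal,
    mul_add, mul_one, add_right_comm, ← mul_add, ← ENNReal.ofReal_add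
    (mul_nonneg hlam hs.1) (mul_nonneg hlam (sub_nonneg.2 hst)), ← mul_add, add_sub_cancel]

lemma measurableSet_mem_range (hT : 0 ≤ T) (i : ℕ) :
    MeasurableSet {ω | i ∈ Finset.range (N T ω)} :=
  hN.pathSigma_le _ (measurableSet_mem_range_pathSigma hT N i)

lemma aemeasurable_arrivalTime (hT : 0 ≤ T) (i : ℕ) : AEMeasurable (arrivalTime T N i) P :=
  ((hN.measurable_arrivalTime_pathSigma hT i).mono hN.pathSigma_le le_rfl).aemeasurable

lemma intensity_arrivalTime (hT : 0 ≤ T) (hlam : 0 ≤ lam) :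
    intensity P (fun ω => Finset.range (N T ω)) (arrivalTime T N) = rateMeasure T lam := by
  refine (Measure.ext_of_Iic _ _ fun a => ?_).symm
  rw [intensity_apply (hN.measurableSet_mem_range hT)
    (hN.aemeasurable_arrivalTime hT) measurableSet_Iic]
  simp only [hN.filter_arrivalTime_mem_Iic hT, Finset.card_range]
  rw [hN.lintegral_eval (Set.projIcc 0 T hT a).2, rateMeasure_Iic hT hlam]

lemma factorialMoment_arrivalTime_Iic (hT : 0 ≤ T) (hlam : 0 ≤ lam) (a b : ℝ) :
    factorialMoment P (fun ω => Finset.range (N T ω)) (arrivalTime T N) (Set.Iic a ×ˢ Set.Iic b) =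
      rateMeasure T lam (Set.Iic a) * rateMeasure T lam (Set.Iic b) := by
  have hcount := factorialMoment_prod_add_intensity_inter
    (hN.measurableSet_mem_range hT) (hN.aemeasurable_arrivalTime hT)
    (measurableSet_Iic (a := a)) (measurableSet_Iic (a := b))
  simp only [hN.filter_arrivalTime_mem_Iic hT, Finset.card_range, hN.intensity_arrivalTime hT hlam,
    Set.Iic_inter_Iic] at hcount
  refine (ENNReal.add_left_inj (measure_ne_top (rateMeasure T lam) (Set.Iic (a ⊓ b)))).1
    (hcount.trans ?_)
  simp only [rateMeasure_Iic hT hlam]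
  rcases le_total a b with h | h
  · rw [hN.lintegral_eval_mul hlam (Subtype.coe_prop _) (Subtype.coe_prop _)
      (Set.monotone_projIcc hT h), inf_eq_left.2 h]
  · simp_rw [mul_comm (N (Set.projIcc 0 T hT a) _ : ℝ≥0∞)]
    rw [hN.lintegral_eval_mul hlam (Subtype.coe_prop _) (Subtype.coe_prop _)
      (Set.monotone_projIcc hT h), inf_eq_right.2 h, mul_comm]

lemma factorialMoment_arrivalTime (hT : 0 ≤ T) (hlam : 0 ≤ lam) :
    factorialMoment P (fun ω => Finset.range (N T ω)) (arrivalTime T N) =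
      (rateMeasure T lam).prod (rateMeasure T lam) := by
  have hgen : MeasurableSpace.generateFrom (Set.range Set.Iic) = borel ℝ :=
    (borel_eq_generateFrom_Iic ℝ).symm
  have hspan : (rateMeasure T lam).FiniteSpanningSetsIn (Set.range Set.Iic) :=
    { set := fun n => Set.Iic n
      set_mem := fun n => ⟨n, rfl⟩
      finite := fun n => measure_lt_top _ _
      spanning := Set.iUnion_eq_univ_iff.2 exists_nat_ge }
  refine (Measure.prod_eq_generateFrom (hgen.trans BorelSpace.measurable_eq.symm)
    (hgen.trans BorelSpace.measurable_eq.symm) isPiSystem_Iic isPiSystem_Iic hspan hspan ?_).symm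
  rintro _ ⟨a, rfl⟩ _ ⟨b, rfl⟩
  exact hN.factorialMoment_arrivalTime_Iic hT hlam a b

end IsPoissonProcess

end Poisson

section Claims

/-- The distribution on `(0, ∞)` of a claim size with density `g`. -/
noncomputable def claimLaw (g : ℝ → ℝ) : Measure ℝ :=
  (volume.restrict (Set.Ioi 0)).withDensity fun y => ENNReal.ofReal (g y)

instance (g : ℝ → ℝ) : SFinite (claimLaw g) := by
  unfold claimLaw
  infer_instance

section Density

variable {T lam t : ℝ} {g : ℝ → ℝ} (hg : Measurable g) (ht : 0 ≤ t)
include hg ht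

lemma restrict_rateMeasure_prod_claimLaw :
    ((rateMeasure T lam).prod (claimLaw g)).restrict (Set.Ioc t T ×ˢ Set.univ) =
      ENNReal.ofReal lam • (volume.restrict (Set.Ioc t T ×ˢ Set.Ioi 0)).withDensity
        fun p => ENNReal.ofReal (g p.2) := by
  rw [← Measure.prod_restrict, Measure.restrict_univ, rateMeasure, claimLaw,
    Measure.restrict_smul, Measure.restrict_restrict measurableSet_Ioc,
    Set.inter_eq_left.2 (Set.Ioc_subset_Ioc_left ht), Measure.prod_smul_left,
    prod_withDensity_right hg.ennreal_ofReal, Measure.prod_restrict, Measure.volume_eq_prod]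

variable {φ : ℝ × ℝ → ℝ}

lemma integrable_indicator_rateMeasure_prod_claimLaw (hg0 : ∀ y, 0 < y → 0 ≤ g y)
    (hφ : IntegrableOn (fun p => φ p * g p.2) (Set.Ioc t T ×ˢ Set.Ioi 0)) :
    Integrable ((Set.Ioc t T ×ˢ Set.univ).indicator φ)
      ((rateMeasure T lam).prod (claimLaw g)) := by
  rw [integrable_indicator_iff (measurableSet_Ioc.prod .univ), IntegrableOn,
    restrict_rateMeasure_prod_claimLaw hg ht]
  have hG : Measurable fun p : ℝ × ℝ => ENNReal.ofReal (g p.2) := by fun_prop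
  refine Integrable.smul_measure ?_ ENNReal.ofReal_ne_top
  rw [integrable_withDensity_iff_integrable_smul' hG
    (ae_of_all _ fun _ => ENNReal.ofReal_lt_top)]
  refine (integrableOn_congr_fun (fun p hp => ?_) (measurableSet_Ioc.prod measurableSet_Ioi)).1 hφ
  rw [ENNReal.toReal_ofReal (hg0 p.2 hp.2), smul_eq_mul, mul_comm]

lemma integral_indicator_rateMeasure_prod_claimLaw (hg0 : ∀ y, 0 < y → 0 ≤ g y) (hlam : 0 ≤ lam) :
    ∫ p, (Set.Ioc t T ×ˢ Set.univ).indicator φ p ∂(rateMeasure T lam).prod (claimLaw g) =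
      lam * ∫ p in Set.Ioc t T ×ˢ Set.Ioi 0, φ p * g p.2 := by
  have hG : Measurable fun p : ℝ × ℝ => ENNReal.ofReal (g p.2) := by fun_prop
  rw [integral_indicator (measurableSet_Ioc.prod .univ),
    restrict_rateMeasure_prod_claimLaw hg ht, integral_smul_measure, ENNReal.toReal_ofReal hlam,
    smul_eq_mul, integral_withDensity_eq_integral_toReal_smul hG
      (ae_of_all _ fun _ => ENNReal.ofReal_lt_top)]
  congr 1
  refine setIntegral_congr_fun (measurableSet_Ioc.prod measurableSet_Ioi) fun p hp => ?_
  simp only [ENNReal.toReal_ofReal (hg0 p.2 hp.2), smul_eq_mul, mul_comm]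

end Density

variable {Ω : Type*} [MeasurableSpace Ω] {P : Measure Ω} {T lam : ℝ} {g : ℝ → ℝ}
  {N : ℝ → Ω → ℕ} {Y : ℕ → Ω → ℝ}

lemma IsPoissonProcess.jumpIntegral_eq_sum (hN : IsPoissonProcess P T lam N) (Y : ℕ → Ω → ℝ)
    (k : ℝ → ℝ → ℝ) {t : ℝ} (ht : t ∈ Set.Icc 0 T) (ω : Ω) :
    jumpIntegral T N Y k t T ω = ∑ i ∈ Finset.range (N T ω),
      (Set.Ioc t T ×ˢ Set.univ).indicator (fun p => k p.1 p.2) (arrivalTime T N i ω, Y i ω) := by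
  classical
  have hIco : Finset.Ico (N t ω) (N T ω) =
      (Finset.range (N T ω)).filter fun i => arrivalTime T N i ω ∈ Set.Ioc t T := by
    ext i
    simp only [Finset.mem_Ico, Finset.mem_filter, Finset.mem_range, Set.mem_Ioc]
    refine ⟨fun ⟨hti, hiT⟩ => ⟨hiT, ?_, ?_⟩, fun ⟨hiT, hti, _⟩ => ⟨?_, hiT⟩⟩
    · rwa [← not_le, hN.arrivalTime_le_iff hiT ht, not_lt]
    · exact (hN.arrivalTime_le_iff hiT ⟨ht.1.trans ht.2, le_rfl⟩).2 hiT
    · rwa [← not_le, hN.arrivalTime_le_iff hiT ht, not_lt] at hti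
  simp only [jumpIntegral, hIco, Finset.sum_filter, Set.indicator_apply, Set.mem_prod,
    Set.mem_univ, and_true]

namespace IsClaimModel

variable (hM : IsClaimModel P T lam g N Y)
include hM

lemma aemeasurable_claim (hT : 0 ≤ T) (i : ℕ) :
    AEMeasurable (fun ω => (arrivalTime T N i ω, Y i ω)) P :=
  (hM.poisson.aemeasurable_arrivalTime hT i).prodMk (hM.law_claim i).aemeasurable

lemma indep_pathSigma :
    Indep (MeasurableSpace.comap (fun ω i => Y i ω) inferInstance) (pathSigma T N) P :=
  (IndepFun_iff_Indep _ _ _).1 hM.indep_arrivals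

lemma intensity_claim [IsProbabilityMeasure P] (hT : 0 ≤ T) (hlam : 0 ≤ lam) :
    intensity P (fun ω => Finset.range (N T ω)) (fun i ω => (arrivalTime T N i ω, Y i ω)) =
      (rateMeasure T lam).prod (claimLaw g) := by
  rw [← hM.poisson.intensity_arrivalTime hT hlam]
  exact intensity_prodMk hM.poisson.pathSigma_le (measurableSet_mem_range_pathSigma hT N)
    (hM.poisson.measurable_arrivalTime_pathSigma hT) (fun i _ _ => hM.law_claim i)
    fun i => indep_of_indep_of_le_left hM.indep_pathSigma
      ((measurable_pi_apply i).comp (comap_measurable fun ω i => Y i ω)).comap_le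

lemma factorialMoment_claim [IsProbabilityMeasure P] (hT : 0 ≤ T) (hlam : 0 ≤ lam) :
    factorialMoment P (fun ω => Finset.range (N T ω)) (fun i ω => (arrivalTime T N i ω, Y i ω)) =
      ((rateMeasure T lam).prod (claimLaw g)).prod ((rateMeasure T lam).prod (claimLaw g)) := by
  rw [← hM.poisson.intensity_arrivalTime hT hlam]
  refine factorialMoment_prodMk hM.poisson.pathSigma_le (measurableSet_mem_range_pathSigma hT N)
    (hM.poisson.measurable_arrivalTime_pathSigma hT) hM.law_claim
    (fun i j hij => hM.indep_claims.indepFun hij) hM.indep_pathSigma ?_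
  rw [hM.poisson.intensity_arrivalTime hT hlam, hM.poisson.factorialMoment_arrivalTime hT hlam]

variable [IsProbabilityMeasure P] (hlam : 0 ≤ lam) (hg : Measurable g)
  (hg0 : ∀ y, 0 < y → 0 ≤ g y) {k : ℝ → ℝ → ℝ} {t : ℝ} (ht : t ∈ Set.Icc 0 T)
  (hk : IntegrableOn (fun p => k p.1 p.2 * g p.2) (Set.Ioc t T ×ˢ Set.Ioi 0))
include hlam hg hg0 ht hk

lemma integral_jumpIntegral :
    ∫ ω, jumpIntegral T N Y k t T ω ∂P =
      lam * ∫ p in Set.Ioc t T ×ˢ Set.Ioi 0, k p.1 p.2 * g p.2 := by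
  have hT : 0 ≤ T := ht.1.trans ht.2
  have hφ := integrable_indicator_rateMeasure_prod_claimLaw (lam := lam) hg ht.1 hg0 hk
  rw [← hM.intensity_claim hT hlam] at hφ
  simp_rw [hM.poisson.jumpIntegral_eq_sum Y k ht]
  exact (integral_sum_comp (hM.poisson.measurableSet_mem_range hT) (hM.aemeasurable_claim hT)
    hφ).trans (hM.intensity_claim hT hlam ▸
      integral_indicator_rateMeasure_prod_claimLaw hg ht.1 hg0 hlam)

variable (hk2 : IntegrableOn (fun p => k p.1 p.2 ^ 2 * g p.2) (Set.Ioc t T ×ˢ Set.Ioi 0))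
include hk2

lemma memLp_two_and_variance_jumpIntegral :
    MemLp (jumpIntegral T N Y k t T) 2 P ∧
      variance (jumpIntegral T N Y k t T) P =
        lam * ∫ p in Set.Ioc t T ×ˢ Set.Ioi 0, k p.1 p.2 ^ 2 * g p.2 := by
  have hT : 0 ≤ T := ht.1.trans ht.2
  have hsq : (Set.Ioc t T ×ˢ Set.univ).indicator (fun p => k p.1 p.2 ^ 2) =
      fun p => (Set.Ioc t T ×ˢ Set.univ).indicator (fun p => k p.1 p.2) p ^ 2 :=
    Set.indicator_comp_of_zero (g := (· ^ 2)) (zero_pow two_ne_zero)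
  have hφ := integrable_indicator_rateMeasure_prod_claimLaw (lam := lam) hg ht.1 hg0 hk
  have hφ2 := integrable_indicator_rateMeasure_prod_claimLaw (lam := lam) hg ht.1 hg0 hk2
  have h₂ := hM.factorialMoment_claim hT hlam
  rw [← hM.intensity_claim hT hlam] at hφ hφ2 h₂
  rw [hsq] at hφ2
  have hI := hM.poisson.measurableSet_mem_range hT
  have hX := hM.aemeasurable_claim hT
  rw [funext (hM.poisson.jumpIntegral_eq_sum Y k ht)]
  refine ⟨memLp_two_sum_comp hI hX h₂ hφ hφ2, (variance_sum_comp hI hX h₂ hφ hφ2).trans ?_⟩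
  rw [hM.intensity_claim hT hlam, ← integral_indicator_rateMeasure_prod_claimLaw hg ht.1 hg0 hlam,
    ← hsq]

end IsClaimModel

end Claims

section Cost

/-- The rate at which coverage `u` of a claim of size `y` lowers the mean–variance criterion, per
unit of claim intensity, where `q` is the density of such claims and `p` is the density used in the
premium. -/
noncomputable def coverageCost (ξ a p q y u : ℝ) : ℝ :=
  (1 + ξ) * u * p + ((y - u) + a / 2 * (y - u) ^ 2) * q

lemma measurable_optimalCoverage {ξ a : ℝ} {gt g : ℝ → ℝ} (hgt : Measurable gt)
    (hg : Measurable g) : Measurable (optimalCoverage ξ a gt g) := by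
  unfold optimalCoverage
  exact Measurable.ite (hg (measurableSet_singleton 0)) (by fun_prop) (by fun_prop)

lemma optimalCoverage_mem_Icc {ξ a : ℝ} {gt g : ℝ → ℝ} {y : ℝ} (hy : 0 ≤ y) :
    optimalCoverage ξ a gt g y ∈ Set.Icc 0 y := by
  unfold optimalCoverage
  split_ifs
  · exact ⟨le_min le_rfl hy, min_le_right _ _⟩
  · exact ⟨le_min (le_max_right _ _) hy, min_le_right _ _⟩

lemma admissible_optimalCoverage {ξ a T : ℝ} {gt g : ℝ → ℝ} (hgt : Measurable gt)
    (hg : Measurable g) : Admissible T fun _ y => optimalCoverage ξ a gt g y :=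
  ⟨(measurable_optimalCoverage hgt hg).comp measurable_snd,
    fun _ _ _ hy => optimalCoverage_mem_Icc hy⟩

lemma sq_clip_sub_le {u v y : ℝ} (hu : u ∈ Set.Icc 0 y) :
    (min (max v 0) y - v) ^ 2 ≤ (u - v) ^ 2 := by
  rw [sq_le_sq]
  rcases le_total v 0 with hv | hv
  · rw [max_eq_right hv, min_eq_left (hu.1.trans hu.2), abs_of_nonneg (by linarith),
      abs_of_nonneg (by linarith [hu.1])]
    linarith [hu.1]
  rw [max_eq_left hv]
  rcases le_total v y with hvy | hvy
  · simp [min_eq_left hvy]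
  · rw [min_eq_right hvy, abs_of_nonpos (by linarith), abs_of_nonpos (by linarith [hu.2])]
    linarith [hu.2]

lemma coverageCost_eq_completed_square {ξ a p q y : ℝ} (ha : a ≠ 0) (hq : q ≠ 0) (u : ℝ) :
    coverageCost ξ a p q y u =
      a * q / 2 * (u - (y + 1 / a - p * (1 + ξ) / (a * q))) ^ 2 +
        (y * q + a * q / 2 * (y ^ 2 - (y + 1 / a - p * (1 + ξ) / (a * q)) ^ 2)) := by
  rw [coverageCost]
  field_simp
  ring

lemma coverageCost_optimalCoverage_le {ξ a : ℝ} (hξ : -1 ≤ ξ) (ha : 0 < a) {gt g : ℝ → ℝ}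
    {y u : ℝ} (hgt : 0 ≤ gt y) (hg : 0 ≤ g y) (hu : u ∈ Set.Icc 0 y) :
    coverageCost ξ a (gt y) (g y) y (optimalCoverage ξ a gt g y) ≤
      coverageCost ξ a (gt y) (g y) y u := by
  rcases hg.eq_or_lt with hzero | hpos
  · have hprice : 0 ≤ (1 + ξ) * u * gt y :=
      mul_nonneg (mul_nonneg (by linarith) hu.1) hgt
    simpa [optimalCoverage, coverageCost, ← hzero, min_eq_left (hu.1.trans hu.2)] using hprice
  · rw [coverageCost_eq_completed_square ha.ne' hpos.ne',
      coverageCost_eq_completed_square ha.ne' hpos.ne', optimalCoverage, if_neg hpos.ne']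
    gcongr ?_ * ?_ + _
    exact sq_clip_sub_le hu

lemma integrableOn_Ioc_prod_of_abs_le {t T : ℝ} {S : Set ℝ} (hS : MeasurableSet S)
    {F : ℝ × ℝ → ℝ} {G : ℝ → ℝ} (hF : Measurable F) (hG : IntegrableOn G S)
    (hle : ∀ p ∈ Set.Ioc t T ×ˢ S, |F p| ≤ G p.2) : IntegrableOn F (Set.Ioc t T ×ˢ S) := by
  have hdom : IntegrableOn (fun p => G p.2) (Set.Ioc t T ×ˢ S) := by
    rw [IntegrableOn, Measure.volume_eq_prod, ← Measure.prod_restrict]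
    exact Integrable.comp_snd hG _
  exact hdom.mono' hF.aestronglyMeasurable
    (ae_restrict_of_forall_mem (measurableSet_Ioc.prod hS) hle)

namespace Admissible

variable {T t : ℝ} {l : ℝ → ℝ → ℝ} (hl : Admissible T l) (ht : t ∈ Set.Icc 0 T)
include hl ht

lemma mem_Icc {p : ℝ × ℝ} (hp : p ∈ Set.Ioc t T ×ˢ Set.Ioi 0) : l p.1 p.2 ∈ Set.Icc 0 p.2 :=
  hl.2 p.1 ⟨ht.1.trans hp.1.1.le, hp.1.2⟩ p.2 (le_of_lt hp.2)

lemma integrableOn_covered {g : ℝ → ℝ} (hg : Measurable g) (hg0 : ∀ y, 0 < y → 0 ≤ g y)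
    (hg1 : IntegrableOn (fun y => y * g y) (Set.Ioi 0)) :
    IntegrableOn (fun p => l p.1 p.2 * g p.2) (Set.Ioc t T ×ˢ Set.Ioi 0) := by
  refine integrableOn_Ioc_prod_of_abs_le measurableSet_Ioi
    (hl.1.mul (hg.comp measurable_snd)) hg1 fun p hp => ?_
  have hlp := hl.mem_Icc ht hp
  rw [abs_of_nonneg (mul_nonneg hlp.1 (hg0 p.2 hp.2))]
  exact mul_le_mul_of_nonneg_right hlp.2 (hg0 p.2 hp.2)

lemma integrableOn_retained_pow {g : ℝ → ℝ} (hg : Measurable g) (hg0 : ∀ y, 0 < y → 0 ≤ g y)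
    {n : ℕ} (hgn : IntegrableOn (fun y => y ^ n * g y) (Set.Ioi 0)) :
    IntegrableOn (fun p => (p.2 - l p.1 p.2) ^ n * g p.2) (Set.Ioc t T ×ˢ Set.Ioi 0) := by
  refine integrableOn_Ioc_prod_of_abs_le measurableSet_Ioi
    (((measurable_snd.sub hl.1).pow_const n).mul (hg.comp measurable_snd)) hgn fun p hp => ?_
  have hlp := hl.mem_Icc ht hp
  have hret : 0 ≤ p.2 - l p.1 p.2 := sub_nonneg.2 hlp.2
  rw [abs_of_nonneg (mul_nonneg (pow_nonneg hret n) (hg0 p.2 hp.2))]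
  exact mul_le_mul_of_nonneg_right (pow_le_pow_left₀ hret (sub_le_self _ hlp.1) n) (hg0 p.2 hp.2)

lemma integrableOn_retained {g : ℝ → ℝ} (hg : IsClaimDensity g) :
    IntegrableOn (fun p => (p.2 - l p.1 p.2) * g p.2) (Set.Ioc t T ×ˢ Set.Ioi 0) := by
  simpa only [pow_one] using hl.integrableOn_retained_pow ht hg.measurable hg.nonneg (n := 1)
    (by simpa only [pow_one] using hg.integrable_mul)

lemma integrableOn_retained_sq {g : ℝ → ℝ} (hg : IsClaimDensity g) :
    IntegrableOn (fun p => (p.2 - l p.1 p.2) ^ 2 * g p.2) (Set.Ioc t T ×ˢ Set.Ioi 0) :=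
  hl.integrableOn_retained_pow ht hg.measurable hg.nonneg hg.integrable_sq_mul

end Admissible

end Cost

section Criterion

variable {Ω : Type*} [MeasurableSpace Ω] {P : Measure Ω} [IsProbabilityMeasure P]
  {T lam t ξ a : ℝ} {gt g : ℝ → ℝ} {N : ℝ → Ω → ℕ} {Y : ℕ → Ω → ℝ} {l : ℝ → ℝ → ℝ}

namespace IsClaimModel

lemma memLp_surplus (hM : IsClaimModel P T lam g N Y) (hlam : 0 ≤ lam) (hg : IsClaimDensity g)
    (hl : Admissible T l) (ht : t ∈ Set.Icc 0 T) (x : ℝ) :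
    MemLp (surplus T lam ξ gt N Y l t x T) 2 P :=
  (memLp_const _).sub (hM.memLp_two_and_variance_jumpIntegral hlam hg.measurable hg.nonneg ht
    (hl.integrableOn_retained ht hg) (hl.integrableOn_retained_sq ht hg)).1

end IsClaimModel

lemma setIntegral_Ioc_prod_snd (htT : t ≤ T) (S : Set ℝ) (F : ℝ → ℝ) :
    ∫ p in Set.Ioc t T ×ˢ S, F p.2 = (T - t) * ∫ y in S, F y := by
  rw [Measure.volume_eq_prod, ← Measure.prod_restrict, integral_fun_snd, measureReal_restrict_apply
    MeasurableSet.univ, Set.univ_inter, Real.volume_real_Ioc_of_le htT, smul_eq_mul]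

lemma integrableOn_retainedCost (hg : IsClaimDensity g) (hl : Admissible T l)
    (ht : t ∈ Set.Icc 0 T) :
    IntegrableOn (fun p => ((p.2 - l p.1 p.2) + a / 2 * (p.2 - l p.1 p.2) ^ 2) * g p.2)
      (Set.Ioc t T ×ˢ Set.Ioi 0) := by
  simp only [add_mul, mul_assoc]
  exact (hl.integrableOn_retained ht hg).add
    ((hl.integrableOn_retained_sq ht hg).const_mul (a / 2))

lemma integral_retainedCost (hg : IsClaimDensity g) (hl : Admissible T l)
    (ht : t ∈ Set.Icc 0 T) :
    ∫ p in Set.Ioc t T ×ˢ Set.Ioi 0,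
        ((p.2 - l p.1 p.2) + a / 2 * (p.2 - l p.1 p.2) ^ 2) * g p.2 =
      (∫ p in Set.Ioc t T ×ˢ Set.Ioi 0, (p.2 - l p.1 p.2) * g p.2) +
        a / 2 * ∫ p in Set.Ioc t T ×ˢ Set.Ioi 0, (p.2 - l p.1 p.2) ^ 2 * g p.2 := by
  rw [← integral_const_mul, ← integral_add (hl.integrableOn_retained ht hg)
    ((hl.integrableOn_retained_sq ht hg).const_mul (a / 2))]
  simp only [add_mul, mul_assoc]

variable (hgt : Measurable gt) (hgt0 : ∀ y, 0 < y → 0 ≤ gt y)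
  (hgt1 : IntegrableOn (fun y => y * gt y) (Set.Ioi 0))
include hgt hgt0 hgt1

lemma integrableOn_premium (hl : Admissible T l) (ht : t ∈ Set.Icc 0 T) :
    IntegrableOn (fun p => (1 + ξ) * l p.1 p.2 * gt p.2) (Set.Ioc t T ×ˢ Set.Ioi 0) := by
  simp only [mul_assoc]
  exact (hl.integrableOn_covered ht hgt hgt0 hgt1).const_mul (1 + ξ)

lemma integral_premiumRate (hl : Admissible T l) (ht : t ∈ Set.Icc 0 T) :
    ∫ s in t..T, premiumRate lam ξ gt l s =
      lam * ∫ p in Set.Ioc t T ×ˢ Set.Ioi 0, (1 + ξ) * l p.1 p.2 * gt p.2 := by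
  rw [Measure.volume_eq_prod, setIntegral_prod _ (integrableOn_premium hgt hgt0 hgt1 hl ht),
    ← integral_const_mul, intervalIntegral.integral_of_le ht.2]
  congr with s
  simp only [premiumRate, mul_assoc, integral_const_mul]
  ring

lemma integral_coverageCost (hg : IsClaimDensity g) (hl : Admissible T l)
    (ht : t ∈ Set.Icc 0 T) :
    ∫ p in Set.Ioc t T ×ˢ Set.Ioi 0, coverageCost ξ a (gt p.2) (g p.2) p.2 (l p.1 p.2) =
      (∫ p in Set.Ioc t T ×ˢ Set.Ioi 0, (1 + ξ) * l p.1 p.2 * gt p.2) +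
        ∫ p in Set.Ioc t T ×ˢ Set.Ioi 0,
          ((p.2 - l p.1 p.2) + a / 2 * (p.2 - l p.1 p.2) ^ 2) * g p.2 :=
  integral_add (integrableOn_premium hgt hgt0 hgt1 hl ht) (integrableOn_retainedCost hg hl ht)

namespace IsClaimModel

variable (hM : IsClaimModel P T lam g N Y) (hlam : 0 ≤ lam) (hg : IsClaimDensity g)
include hM hlam hg

lemma criterion_eq (hl : Admissible T l) (ht : t ∈ Set.Icc 0 T) (x : ℝ) :
    criterion P T lam ξ a gt N Y t x l = x - lam * ∫ p in Set.Ioc t T ×ˢ Set.Ioi 0,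
      coverageCost ξ a (gt p.2) (g p.2) p.2 (l p.1 p.2) := by
  have hret := hl.integrableOn_retained ht hg
  obtain ⟨hmem, hvar⟩ := hM.memLp_two_and_variance_jumpIntegral hlam hg.measurable hg.nonneg
    (k := fun s y => y - l s y) ht hret (hl.integrableOn_retained_sq ht hg)
  have hmean := hM.integral_jumpIntegral hlam hg.measurable hg.nonneg
    (k := fun s y => y - l s y) ht hret
  unfold criterion surplus
  rw [integral_sub (integrable_const _) (hmem.integrable one_le_two),
    variance_const_sub hmem.aestronglyMeasurable, hmean, hvar, integral_const, probReal_univ,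
    one_smul, integral_premiumRate hgt hgt0 hgt1 hl ht,
    integral_coverageCost hgt hgt0 hgt1 hg hl ht, integral_retainedCost hg hl ht]
  ring

lemma criterion_const {u : ℝ → ℝ} (hu : Admissible T fun _ y => u y) (ht : t ∈ Set.Icc 0 T)
    (x : ℝ) :
    criterion P T lam ξ a gt N Y t x (fun _ y => u y) = x - lam * (T - t) *
      ((∫ y in Set.Ioi 0, (1 + ξ) * u y * gt y) +
        ∫ y in Set.Ioi 0, ((y - u y) + a / 2 * (y - u y) ^ 2) * g y) := by
  rw [hM.criterion_eq hgt hgt0 hgt1 hlam hg hu ht, integral_coverageCost hgt hgt0 hgt1 hg hu ht,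
    setIntegral_Ioc_prod_snd ht.2 _ fun y => (1 + ξ) * u y * gt y,
    setIntegral_Ioc_prod_snd ht.2 _ fun y => ((y - u y) + a / 2 * (y - u y) ^ 2) * g y]
  ring

lemma criterion_le_optimalCoverage (hξ : -1 ≤ ξ) (ha : 0 < a) (hl : Admissible T l)
    (ht : t ∈ Set.Icc 0 T) (x : ℝ) :
    criterion P T lam ξ a gt N Y t x l ≤
      criterion P T lam ξ a gt N Y t x fun _ y => optimalCoverage ξ a gt g y := by
  have hopt := admissible_optimalCoverage (ξ := ξ) (a := a) (T := T) hgt hg.measurable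
  have hcost {k : ℝ → ℝ → ℝ} (hk : Admissible T k) : IntegrableOn
      (fun p => coverageCost ξ a (gt p.2) (g p.2) p.2 (k p.1 p.2)) (Set.Ioc t T ×ˢ Set.Ioi 0) :=
    (integrableOn_premium hgt hgt0 hgt1 hk ht).add (integrableOn_retainedCost hg hk ht)
  rw [hM.criterion_eq hgt hgt0 hgt1 hlam hg hl ht,
    hM.criterion_eq hgt hgt0 hgt1 hlam hg hopt ht]
  gcongr x - lam * ?_
  exact setIntegral_mono_on (hcost hopt) (hcost hl) (measurableSet_Ioc.prod measurableSet_Ioi)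
    fun p hp => coverageCost_optimalCoverage_le hξ ha (hgt0 p.2 hp.2) (hg.nonneg p.2 hp.2)
      (hl.mem_Icc ht hp)

end IsClaimModel

end Criterion

section Optimality

variable {T : ℝ} {J : ℝ → ℝ → (ℝ → ℝ → ℝ) → ℝ} {l : ℝ → ℝ → ℝ}

lemma isEquilibrium_of_isMaxOn (hl : Admissible T l)
    (hmax : ∀ t ∈ Set.Icc 0 T, ∀ x, IsMaxOn (J t x) {l | Admissible T l} l) :
    IsEquilibrium T J l := by
  refine ⟨hl, fun t ht x lbar hlbar => le_liminf_of_le (by isBoundedDefault) ?_⟩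
  filter_upwards [hlbar, self_mem_nhdsWithin] with ε hε hε0
  exact_mod_cast div_nonneg (sub_nonneg.2 (hmax t ht x hε)) (le_of_lt hε0)

lemma customerValue_eq_of_isMaxOn {x : ℝ} (hl : Admissible T l)
    (hmax : IsMaxOn (J 0 x) {l | Admissible T l} l) : customerValue T J x = J 0 x l :=
  IsGreatest.csSup_eq ⟨Set.mem_image_of_mem _ hl, Set.forall_mem_image.2 fun _ h => hmax h⟩

end Optimality

end RiskType

open RiskType in
theorem proposition4p1_general {Ω : Type*} [MeasurableSpace Ω] (P : Measure Ω)
    [IsProbabilityMeasure P] (T lam : ℝ) (hT : 0 ≤ T) (hlam : 0 ≤ lam) (ξ a : ℝ) (hξ : -1 ≤ ξ)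
    (ha : 0 < a) (gt g : ℝ → ℝ) (hgt : Measurable gt) (hgt0 : ∀ y, 0 < y → 0 ≤ gt y)
    (hgt1 : IntegrableOn (fun y => y * gt y) (Set.Ioi 0)) (hg : IsClaimDensity g)
    (N : ℝ → Ω → ℕ) (Y : ℕ → Ω → ℝ) (hM : IsClaimModel P T lam g N Y) (xC : ℝ)
    (J : ℝ → ℝ → (ℝ → ℝ → ℝ) → ℝ) (hJ : J = criterion P T lam ξ a gt N Y)
    (lhat : ℝ → ℝ) (hlhat : lhat = optimalCoverage ξ a gt g) :
    (∀ l, Admissible T l → ∀ t ∈ Set.Icc 0 T, ∀ x : ℝ,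
      MemLp (surplus T lam ξ gt N Y l t x T) 2 P) ∧
    IsEquilibrium T J (fun _ y => lhat y) ∧
    IsMaxOn (J 0 xC) {l | Admissible T l} (fun _ y => lhat y) ∧
    J 0 xC (fun _ y => lhat y) = customerValue T J xC ∧
    customerValue T J xC = xC - lam * T *
      ((∫ y in Set.Ioi (0 : ℝ), (1 + ξ) * lhat y * gt y) +
        ∫ y in Set.Ioi (0 : ℝ), ((y - lhat y) + a / 2 * (y - lhat y) ^ 2) * g y) := by
  subst hJ hlhat
  have h0 : (0 : ℝ) ∈ Set.Icc 0 T := ⟨le_rfl, hT⟩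
  have hopt := admissible_optimalCoverage (ξ := ξ) (a := a) (T := T) hgt hg.measurable
  have hmax : ∀ t ∈ Set.Icc 0 T, ∀ x, IsMaxOn (criterion P T lam ξ a gt N Y t x)
      {l | Admissible T l} fun _ y => optimalCoverage ξ a gt g y := fun t ht x l hl =>
    hM.criterion_le_optimalCoverage hgt hgt0 hgt1 hlam hg hξ ha hl ht x
  have hvalue := customerValue_eq_of_isMaxOn hopt (hmax 0 h0 xC)
  refine ⟨fun l hl t ht x => hM.memLp_surplus hlam hg hl ht x, isEquilibrium_of_isMaxOn hopt hmax,
    hmax 0 h0 xC, hvalue.symm, ?_⟩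
  rw [hvalue, hM.criterion_const hgt hgt0 hgt1 hlam hg hopt h0, sub_zero]

theorem proposition4p1 {Ω : Type*} [MeasurableSpace Ω] (P : MeasureTheory.Measure Ω)
    [MeasureTheory.IsProbabilityMeasure P]
    (T lam : ℝ) (hT : 0 < T) (hlam : 0 < lam)
    (θL θH : ℝ)
    (f : ℝ → ℝ → ℝ) (hf : ∀ θ ∈ Set.Icc θL θH, RiskType.IsClaimDensity (f θ))
    (γ : ℝ → ℝ) (hγ : ∀ θ ∈ Set.Icc θL θH, 0 < γ θ)
    (ξ : ℝ → ℝ) (hξ : ∀ θ ∈ Set.Icc θL θH, 0 ≤ ξ θ)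
    (θ : ℝ) (hθ : θ ∈ Set.Icc θL θH) (θt : ℝ) (hθt : θt ∈ Set.Icc θL θH)
    (N : ℝ → Ω → ℕ) (Y : ℕ → Ω → ℝ) (hNY : RiskType.IsClaimModel P T lam (f θ) N Y)
    (xC : ℝ)
    (J : ℝ → ℝ → (ℝ → ℝ → ℝ) → ℝ)
    (hJ : J = RiskType.criterion P T lam (ξ θt) (γ θ) (f θt) N Y)
    (lhat : ℝ → ℝ) (hlhat : lhat = RiskType.optimalCoverage (ξ θt) (γ θ) (f θt) (f θ)) :
    -- terminal surpluses are square-integrable, so the criterion is well defined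
    (∀ l, RiskType.Admissible T l → ∀ t ∈ Set.Icc 0 T, ∀ x : ℝ,
      MeasureTheory.MemLp (RiskType.surplus T lam (ξ θt) (f θt) N Y l t x T) 2 P) ∧
    -- the coverage is optimal, in the equilibrium sense and for the problem at time zero
    RiskType.IsEquilibrium T J (fun _ y => lhat y) ∧
    IsMaxOn (J 0 xC) {l | RiskType.Admissible T l} (fun _ y => lhat y) ∧
    -- the value function
    J 0 xC (fun _ y => lhat y) = RiskType.customerValue T J xC ∧
    RiskType.customerValue T J xC =
      xC - lam * T *
        ((∫ y in Set.Ioi (0 : ℝ), (1 + ξ θt) * lhat y * f θt y) +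
          ∫ y in Set.Ioi (0 : ℝ),
            ((y - lhat y) + γ θ / 2 * (y - lhat y) ^ 2) * f θ y) :=
  proposition4p1_general P T lam hT.le hlam.le (ξ θt) (γ θ) (by linarith [hξ θt hθt]) (hγ θ hθ)
    (f θt) (f θ) (hf θt hθt).measurable (hf θt hθt).nonneg (hf θt hθt).integrable_mul (hf θ hθ)
    N Y hNY xC J hJ lhat hlhat
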